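/- Consider the linear delay differential equation $$\dot x(t)+a(t)x(t)+b(t)x(h(t))=0,\qquad t\ge 0, \tag{1}$$ where $a,b:[0,\infty)\to[0,\infty)$ are Lebesgue measurable and essentially bounded, and $h:[0,\infty)\to\mathbb R$ is Lebesgue measurable with $h(t)\le t$ and $\lim_{t\to\infty}h(t)=\infty$. For $t_0\ge 0$ and a bounded Borel measurable function $\varphi:(-\infty,t_0]\to\mathbb R$, a solution of (1) with initial point $t_0$ and initial function $\varphi$ is a function $x:\mathbb R\to\mathbb R$ with $x(t)=\varphi(t)$ for $t\le t_0$ which is absolutely continuous on every interval $[t_0,T]$, $T\ge t_0$, and satisfies (1) for almost every $t\ge t_0$. Equation (1) is called exponentially stable if there are constants $M>0$ and $\alpha>0$ such that, for all $t_0\ge0$ and all such $\varphi$, every solution satisfies $$|x(t)|\le M\,\sup_{s\le t_0}|\varphi(s)|\;e^{-\alpha(t-t_0)},\qquad t\ge t_0 .$$ **Theorem 2.** Suppose that $a(t)\ge a_0>0$ and $b(t)\ge 0$ for all $t\ge0$, that $$h_0:=\limsup_{t\to\infty}\int_{h(t)}^t a(s)\,ds<\infty ,\qquad \beta:=\limsup_{t\to\infty}\frac{b(t)}{a(t)}<\infty,$$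 and that $$\frac1\beta\,e^{-h_0}>\ln\frac{\beta^2+\beta}{\beta^2+1},$$ where for $\beta=0$ this inequality is regarded as satisfied ($+\infty>-\infty$). Then equation (1) is exponentially stable. -/

import Mathlib

open Real Set Filter Topology MeasureTheory

/-- `x` is a solution of `x'(t) + a(t) x(t) + b(t) x(h(t)) = 0` for `t ≥ t₀` with initial condition
`x(t) = φ(t)` for `t ≤ t₀`: it is absolutely continuous on every compact interval `[t₀, T]` and
satisfies the equation at almost every `t ≥ t₀`. -/
structure IsDelaySolution (a b h : ℝ → ℝ) (t₀ : ℝ) (φ x : ℝ → ℝ) : Prop where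
  initial : ∀ t ≤ t₀, x t = φ t
  absCont : ∀ T ≥ t₀, AbsolutelyContinuousOnInterval x t₀ T
  equation : ∀ᵐ t ∂(volume.restrict (Ici t₀)), HasDerivAt x (-(a t * x t) - b t * x (h t)) t

/-- Admissible initial functions at `t₀`: Borel measurable and bounded on `(-∞, t₀]`. -/
structure IsInitialFunction (t₀ : ℝ) (φ : ℝ → ℝ) : Prop where
  measurable : Measurable (fun s : Iic t₀ => φ s)
  bounded : ∃ C : ℝ, ∀ s ≤ t₀, |φ s| ≤ C

/-- Exponential stability of `x'(t) + a(t) x(t) + b(t) x(h(t)) = 0`, `t ≥ 0`: there are `M, α > 0`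
such that for every initial point `t₀ ≥ 0` and every admissible initial function `φ`, solutions
satisfy `|x(t)| ≤ M ‖φ‖ exp (-α (t - t₀))` for `t ≥ t₀`, where `‖φ‖` is the sup-norm
on `(-∞, t₀]`. -/
def IsExponentiallyStable (a b h : ℝ → ℝ) : Prop :=
  ∃ M > 0, ∃ α > 0, ∀ t₀ ≥ 0, ∀ φ x : ℝ → ℝ, IsInitialFunction t₀ φ →
    IsDelaySolution a b h t₀ φ x →
      ∀ t ≥ t₀, |x t| ≤ M * (⨆ s : Iic t₀, |φ s|) * Real.exp (-α * (t - t₀))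

/-! The proof combines an exponential weight with a sharp estimate between consecutive zeros.

If `x` solves the equation, then `z t = exp (α (t - t₀)) * x t` solves the equation with
coefficients `a - α` and `b exp (α (t - h))` (`SolvesFrom.exp_mul`). The delay `t - h t` is bounded
for large `t` because `a ≥ a₀`, and the hypothesis on `β` and `h₀` is an open condition
(`exists_contractionFactor_lt_one`), so for small `α` the weighted equation satisfies it too
(`isDelayRegime_exp_mul`). Exponential stability therefore reduces to boundedness of `z`.

Boundedness follows by looking at a maximum `T` of `|z|`, say `z T = W > 0`. Time is measured by
the primitive `A` of the coefficient of `z`, so that `(exp A * z)' = -exp A * b * z (h)`. If `z` has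
no zero shortly before `T`, it decays there. Otherwise let `σ` be the last zero. The bound
`|z| ≤ W` alone gives `-z s ≤ β W (exp (A σ - A s) - 1)` for `s ≤ σ`; used for the delayed values,
it yields, for `σ ≤ t` and `A t ≤ A σ + τ`,
`(exp A * z)' ≤ W a exp A * min β (β ^ 2 (exp (A σ + τ - A t) - 1))`,
whose integral gives `z ≤ κ W` with
`κ = β (β + 1) exp (-exp (-τ) / β) - β ^ 2` (`IsDelayRegime.le_after_zero`). The condition
on `β` and `h₀`, with `τ` in place of `h₀`, says that `κ < 1` (`contractionFactor_lt_one`). After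
that `z` decreases, and `z T ≤ κ W < W` is a contradiction. The initial stretch, on which the
asymptotic bounds are not yet available, is controlled by the growth estimate
`SolvesFrom.abs_le_exp`.

The value of `κ` presupposes `log (1 + 1 / β) ≤ τ`, so that the minimum above is at first `β`. This
is no restriction: once `β > 1`, enlarging `τ` to `log (1 + 1 / β)` keeps `κ < 1`. -/

/-! ### Absolutely continuous functions -/

theorem AbsolutelyContinuousOnInterval.exp_comp {f : ℝ → ℝ} {p q : ℝ}
    (hf : AbsolutelyContinuousOnInterval f p q) :
    AbsolutelyContinuousOnInterval (fun t => Real.exp (f t)) p q := by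
  obtain ⟨C, hC⟩ := hf.exists_bound
  -- `exp` is Lipschitz with constant `exp C` on `(-∞, C]`
  have hlip : ∀ u ≤ C, ∀ v ≤ C, Real.exp u - Real.exp v ≤ Real.exp C * |u - v| := by
    intro u hu v hv
    have h1 : Real.exp u * (v - u + 1) ≤ Real.exp v := by
      calc Real.exp u * (v - u + 1) ≤ Real.exp u * Real.exp (v - u) := by
            gcongr; exact Real.add_one_le_exp _
        _ = Real.exp v := by rw [← Real.exp_add]; ring_nf
    calc Real.exp u - Real.exp v ≤ Real.exp u * (u - v) := by linarith
      _ ≤ Real.exp u * |u - v| := by gcongr; exact le_abs_self _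
      _ ≤ Real.exp C * |u - v| := by gcongr
  rw [absolutelyContinuousOnInterval_iff] at hf ⊢
  intro ε hε
  obtain ⟨δ, hδ, h⟩ := hf (ε / Real.exp C) (by positivity)
  refine ⟨δ, hδ, fun E hE hlen => ?_⟩
  have h1 := h E hE hlen
  rw [lt_div_iff₀ (Real.exp_pos C), Finset.sum_mul] at h1
  refine (Finset.sum_le_sum fun i hi => ?_).trans_lt h1
  have hb : ∀ s ∈ uIcc p q, f s ≤ C := fun s hs => (le_abs_self _).trans (hC s hs)
  have hu := hb _ (hE.1 i hi).1
  have hv := hb _ (hE.1 i hi).2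
  rw [Real.dist_eq, Real.dist_eq, mul_comm, abs_sub_le_iff]
  refine ⟨hlip _ hu _ hv, ?_⟩
  rw [abs_sub_comm]
  exact hlip _ hv _ hu

theorem AbsolutelyContinuousOnInterval.le_of_ae_hasDerivAt_nonpos {F : ℝ → ℝ} {p q : ℝ}
    (hpq : p ≤ q) (hF : AbsolutelyContinuousOnInterval F p q)
    (hd : ∀ᵐ t, t ∈ Icc p q → ∃ d ≤ 0, HasDerivAt F d t) : F q ≤ F p := by
  have h1 := hF.integral_deriv_eq_sub
  have h2 : ∫ t in p..q, deriv F t ≤ 0 := by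
    rw [intervalIntegral.integral_of_le hpq]
    refine integral_nonpos_of_ae ?_
    rw [EventuallyLE, ae_restrict_iff' measurableSet_Ioc]
    filter_upwards [hd] with t ht hmem
    obtain ⟨d, hd0, hdt⟩ := ht (Ioc_subset_Icc_self hmem)
    simpa [hdt.deriv] using hd0
  linarith

theorem AbsolutelyContinuousOnInterval.mono_Icc {F : ℝ → ℝ} {t₁ p q T : ℝ}
    (hF : AbsolutelyContinuousOnInterval F t₁ T) (hp : t₁ ≤ p) (hpq : p ≤ q) (hq : q ≤ T) :
    AbsolutelyContinuousOnInterval F p q := by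
  refine hF.mono ?_
  rw [uIcc_of_le hpq, uIcc_of_le (hp.trans (hpq.trans hq))]
  exact Icc_subset_Icc hp hq

/-! ### The contraction estimate -/

/-- `A` is a primitive of the coefficient `a` on `[t₁, ∞)`, the ratio `b / a` is at most `β`, and
the delay, measured in the intrinsic time `A`, is at most `τ` as soon as the intrinsic time elapsed
since `t₁` is at least `τ`. -/
structure IsDelayRegime (A a b h : ℝ → ℝ) (β τ t₁ : ℝ) : Prop where
  absCont : ∀ T ≥ t₁, AbsolutelyContinuousOnInterval A t₁ T
  hasDerivAt : ∀ᵐ t, t₁ ≤ t → HasDerivAt A (a t) t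
  strictMonoOn : StrictMonoOn A (Ici t₁)
  nonneg : ∀ t ≥ t₁, 0 ≤ b t
  le_mul : ∀ t ≥ t₁, b t ≤ β * a t
  delay_le : ∀ t ≥ t₁, h t ≤ t
  delay : ∀ t ≥ t₁, A t₁ + τ ≤ A t → t₁ ≤ h t ∧ A t ≤ A (h t) + τ

/-- `z` is absolutely continuous and solves `z' + a z + b z(h) = 0` almost everywhere on
`[t₁, ∞)`; nothing is asked of `z` before `t₁`. -/
structure SolvesFrom (a b h : ℝ → ℝ) (t₁ : ℝ) (z : ℝ → ℝ) : Prop where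
  absCont : ∀ T ≥ t₁, AbsolutelyContinuousOnInterval z t₁ T
  equation : ∀ᵐ t, t₁ ≤ t → HasDerivAt z (-(a t * z t) - b t * z (h t)) t

/-- The bound for a solution after a zero, relative to a bound for `|z|` up to then. It is the
maximum of the explicit solution of the extremal comparison problem when
`log (1 + 1 / β) ≤ τ`. -/
noncomputable def contractionFactor (β τ : ℝ) : ℝ :=
  β * (β + 1) * Real.exp (-(Real.exp (-τ) / β)) - β ^ 2

variable {A a b h z : ℝ → ℝ} {β τ t₁ : ℝ}

theorem SolvesFrom.neg (hz : SolvesFrom a b h t₁ z) : SolvesFrom a b h t₁ (fun t => -z t) where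
  absCont T hT := (hz.absCont T hT).neg
  equation := by
    filter_upwards [hz.equation] with t ht h1
    exact (ht h1).neg.congr_deriv (by ring)

/-- Comparison of `exp A * z` with the primitive of `(k₁ exp A + k₂) a`. -/
theorem IsDelayRegime.comparison (R : IsDelayRegime A a b h β τ t₁) (hz : SolvesFrom a b h t₁ z)
    {p q : ℝ} (hp : t₁ ≤ p) (hpq : p ≤ q) (k₁ k₂ : ℝ)
    (hk : ∀ t ∈ Icc p q,
      -(b t * z (h t)) * Real.exp (A t) ≤ (k₁ * Real.exp (A t) + k₂) * a t) :
    Real.exp (A q) * z q - (k₁ * Real.exp (A q) + k₂ * A q)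
      ≤ Real.exp (A p) * z p - (k₁ * Real.exp (A p) + k₂ * A p) := by
  have hA := (R.absCont q (hp.trans hpq)).mono_Icc hp hpq le_rfl
  have hZ := (hz.absCont q (hp.trans hpq)).mono_Icc hp hpq le_rfl
  have hF : AbsolutelyContinuousOnInterval
      (fun t => Real.exp (A t) * z t - (k₁ * Real.exp (A t) + k₂ * A t)) p q :=
    (hA.exp_comp.mul hZ).sub ((hA.exp_comp.const_mul k₁).add (hA.const_mul k₂))
  refine hF.le_of_ae_hasDerivAt_nonpos hpq ?_
  filter_upwards [R.hasDerivAt, hz.equation] with t hAt hzt ht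
  have hAt := hAt (hp.trans ht.1)
  have hzt := hzt (hp.trans ht.1)
  refine ⟨_, ?_, (hAt.exp.mul hzt).sub ((hAt.exp.const_mul k₁).add (hAt.const_mul k₂))⟩
  have := hk t ht
  nlinarith

theorem IsDelayRegime.exists_eq (R : IsDelayRegime A a b h β τ t₁) {T v : ℝ} (hT : t₁ ≤ T)
    (h1 : A t₁ ≤ v) (h2 : v ≤ A T) : ∃ s ∈ Icc t₁ T, A s = v := by
  have hc := (R.absCont T hT).continuousOn
  rw [uIcc_of_le hT] at hc
  exact intermediate_value_Icc hT hc ⟨h1, h2⟩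

theorem IsDelayRegime.le_of_le (R : IsDelayRegime A a b h β τ t₁) {s t : ℝ} (hs : t₁ ≤ s)
    (ht : t₁ ≤ t) (hst : A s ≤ A t) : s ≤ t :=
  (R.strictMonoOn.le_iff_le hs ht).1 hst

theorem IsDelayRegime.mono (R : IsDelayRegime A a b h β τ t₁) {s t : ℝ} (hs : t₁ ≤ s)
    (hst : s ≤ t) : A s ≤ A t :=
  R.strictMonoOn.monotoneOn hs (hs.trans hst) hst

/-- The upper bound `β (1 - e^{-r})` of the first phase, at its end, is below the contraction
factor. -/
theorem first_phase_le (hβ : 0 < β) :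
    β * (1 - (1 + 1 / β) * Real.exp (-τ)) ≤ contractionFactor β τ := by
  have h1 := Real.add_one_le_exp (-(Real.exp (-τ) / β))
  have h2 : β * (β + 1) * (-(Real.exp (-τ) / β) + 1)
      ≤ β * (β + 1) * Real.exp (-(Real.exp (-τ) / β)) := by gcongr
  have h3 : β * (1 - (1 + 1 / β) * Real.exp (-τ))
      = β * (β + 1) * (-(Real.exp (-τ) / β) + 1) - β ^ 2 := by field_simp; ring
  rw [contractionFactor, h3]
  linarith

/-- From a zero `σ` of a solution with `|z| ≤ W`, the solution stays below `κ W` up to the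
intrinsic time `A σ + τ`. -/
theorem IsDelayRegime.le_after_zero (R : IsDelayRegime A a b h β τ t₁)
    (hz : SolvesFrom a b h t₁ z) (hβ : 0 < β) (hτ : Real.log (1 + 1 / β) ≤ τ) {W T σ : ℝ}
    (hW : ∀ s ≤ T, |z s| ≤ W) (hσ1 : t₁ ≤ σ) (hσ : A t₁ + τ ≤ A σ) (hσT : σ ≤ T)
    (hzσ : z σ = 0) (hpos : ∀ s ∈ Icc σ T, 0 ≤ z s) (hT : A T ≤ A σ + τ) :
    z T ≤ contractionFactor β τ * W := by
  have hW0 : 0 ≤ W := (abs_nonneg _).trans (hW T le_rfl)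
  -- the delayed term never exceeds `β W a`
  have hcrude : ∀ t ∈ Icc t₁ T,
      -(b t * z (h t)) * Real.exp (A t) ≤ (β * W * Real.exp (A t) + 0) * a t := by
    intro t ht
    have h1 := (abs_le.1 (hW (h t) ((R.delay_le t ht.1).trans ht.2))).1
    have h2 : b t * -z (h t) ≤ (β * a t) * W :=
      (mul_le_mul_of_nonneg_left (by linarith) (R.nonneg t ht.1)).trans
        (mul_le_mul_of_nonneg_right (R.le_mul t ht.1) hW0)
    nlinarith [mul_le_mul_of_nonneg_right h2 (Real.exp_pos (A t)).le]
  -- lower bound for `z` before its zero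
  have hlow : ∀ s ∈ Icc t₁ σ, -z s ≤ β * W * (Real.exp (A σ - A s) - 1) := by
    intro s hs
    have h1 := R.comparison hz hs.1 hs.2 (β * W) 0
      fun t ht => hcrude t ⟨hs.1.trans ht.1, ht.2.trans hσT⟩
    rw [hzσ] at h1
    have h2 : Real.exp (A σ) = Real.exp (A σ - A s) * Real.exp (A s) := by
      rw [← Real.exp_add]; ring_nf
    rw [h2] at h1
    refine le_of_mul_le_mul_right ?_ (Real.exp_pos (A s))
    linarith
  have hfine : ∀ t ∈ Icc σ T, -(b t * z (h t)) * Real.exp (A t) ≤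
      (-(β ^ 2 * W) * Real.exp (A t) + β ^ 2 * W * Real.exp (A σ + τ)) * a t := by
    intro t ht
    have ht1 : t₁ ≤ t := hσ1.trans ht.1
    obtain ⟨h1, h2⟩ := R.delay t ht1 (hσ.trans (R.mono hσ1 ht.1))
    have htT : A t ≤ A σ + τ := (R.mono ht1 ht.2).trans hT
    have hu : -z (h t) ≤ β * W * (Real.exp (A σ + τ - A t) - 1) := by
      rcases le_total σ (h t) with hh | hh
      · have h3 := hpos (h t) ⟨hh, (R.delay_le t ht1).trans ht.2⟩
        have h4 : 1 ≤ Real.exp (A σ + τ - A t) := Real.one_le_exp (by linarith)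
        have : 0 ≤ β * W * (Real.exp (A σ + τ - A t) - 1) :=
          mul_nonneg (by positivity) (by linarith)
        linarith
      · have h3 : Real.exp (A σ - A (h t)) ≤ Real.exp (A σ + τ - A t) :=
          Real.exp_le_exp.2 (by linarith)
        exact (hlow _ ⟨h1, hh⟩).trans (by gcongr)
    have h4 : 1 ≤ Real.exp (A σ + τ - A t) := Real.one_le_exp (by linarith)
    have h3 : b t * -z (h t) ≤ (β * a t) * (β * W * (Real.exp (A σ + τ - A t) - 1)) :=
      (mul_le_mul_of_nonneg_left hu (R.nonneg t ht1)).trans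
        (mul_le_mul_of_nonneg_right (R.le_mul t ht1)
          (mul_nonneg (by positivity) (by linarith)))
    have h5 : Real.exp (A σ + τ) = Real.exp (A σ + τ - A t) * Real.exp (A t) := by
      rw [← Real.exp_add]; ring_nf
    rw [h5]
    nlinarith [mul_le_mul_of_nonneg_right h3 (Real.exp_pos (A t)).le]
  have hc0 : (0 : ℝ) < 1 + 1 / β := by positivity
  -- first phase: the crude bound, up to intrinsic time `A σ + τ - log (1 + 1 / β)`
  have hphase : ∀ t ∈ Icc σ T, A t ≤ A σ + (τ - Real.log (1 + 1 / β)) →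
      z t ≤ β * W * (1 - (1 + 1 / β) * Real.exp (-τ)) := by
    intro t ht hA
    have h1 := R.comparison hz hσ1 ht.1 (β * W) 0
      fun s hs => hcrude s ⟨hσ1.trans hs.1, hs.2.trans ht.2⟩
    have h2 : (1 + 1 / β) * Real.exp (-τ) = Real.exp (Real.log (1 + 1 / β) - τ) := by
      rw [sub_eq_add_neg, Real.exp_add, Real.exp_log hc0]
    have h3 : (1 + 1 / β) * Real.exp (-τ) ≤ Real.exp (A σ - A t) := by
      rw [h2]; exact Real.exp_le_exp.2 (by linarith)
    have h4 : Real.exp (A σ) = Real.exp (A σ - A t) * Real.exp (A t) := by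
      rw [← Real.exp_add]; ring_nf
    have h5 : z t ≤ β * W * (1 - Real.exp (A σ - A t)) := by
      rw [hzσ, h4] at h1
      refine le_of_mul_le_mul_right ?_ (Real.exp_pos (A t))
      linarith
    refine h5.trans ?_
    gcongr
  rcases le_total (A T) (A σ + (τ - Real.log (1 + 1 / β))) with hcase | hcase
  · refine (hphase T ⟨hσT, le_rfl⟩ hcase).trans ?_
    have := mul_le_mul_of_nonneg_right (first_phase_le (τ := τ) hβ) hW0
    linarith
  -- second phase: the fine bound
  obtain ⟨p, hp, hAp⟩ := R.exists_eq (hσ1.trans hσT)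
    (v := A σ + (τ - Real.log (1 + 1 / β)))
    (by linarith [R.mono le_rfl hσ1]) hcase
  have hσp : σ ≤ p := R.le_of_le hσ1 hp.1 (by linarith)
  have h1 := R.comparison hz hp.1 hp.2 (-(β ^ 2 * W)) (β ^ 2 * W * Real.exp (A σ + τ))
    fun t ht => hfine t ⟨hσp.trans ht.1, ht.2⟩
  have h2 := hphase p ⟨hσp, hp.2⟩ hAp.le
  have h3 : Real.exp (A σ + τ) = Real.exp (A p) * (1 + 1 / β) := by
    rw [hAp, ← Real.exp_log hc0, ← Real.exp_add, Real.exp_log hc0]; ring_nf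
  have h4 : Real.exp (A p) = Real.exp (-(A T - A p)) * Real.exp (A T) := by
    rw [← Real.exp_add]; ring_nf
  rw [h3, h4] at h1
  set d := A T - A p with hd
  have h5 : z T ≤ Real.exp (-d) * z p + β ^ 2 * W * Real.exp (-d)
      + β ^ 2 * W * (1 + 1 / β) * Real.exp (-d) * d - β ^ 2 * W := by
    refine le_of_mul_le_mul_right ?_ (Real.exp_pos (A T))
    have : A T = A p + d := by rw [hd]; ring
    generalize Real.exp (A T) = X at h1 ⊢
    rw [this] at h1
    linarith
  have h6 : Real.exp (-d) * z p
      ≤ Real.exp (-d) * (β * W * (1 - (1 + 1 / β) * Real.exp (-τ))) := by gcongr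
  have h7 : (1 - Real.exp (-τ) / β + d) * Real.exp (-d) ≤ Real.exp (-(Real.exp (-τ) / β)) := by
    calc (1 - Real.exp (-τ) / β + d) * Real.exp (-d)
        ≤ Real.exp (d - Real.exp (-τ) / β) * Real.exp (-d) := by
          gcongr
          linarith [Real.add_one_le_exp (d - Real.exp (-τ) / β)]
      _ = _ := by rw [← Real.exp_add]; ring_nf
  have h8 := mul_le_mul_of_nonneg_left h7 (show 0 ≤ β * (β + 1) * W by positivity)
  have h9 : Real.exp (-d) * (β * W * (1 - (1 + 1 / β) * Real.exp (-τ)))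
      + β ^ 2 * W * Real.exp (-d) + β ^ 2 * W * (1 + 1 / β) * Real.exp (-d) * d
      = β * (β + 1) * W * ((1 - Real.exp (-τ) / β + d) * Real.exp (-d)) := by
    field_simp; ring
  rw [contractionFactor]
  linarith

/-- If `|z| ≤ W` on `(-∞, T]` and `T` lies far enough beyond `t₁`, then `z T` is at most a fixed
fraction of `W`. -/
theorem IsDelayRegime.le_contraction (R : IsDelayRegime A a b h β τ t₁)
    (hz : SolvesFrom a b h t₁ z) (hβ : 0 < β) (hτ : Real.log (1 + 1 / β) ≤ τ) {W T : ℝ}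
    (hW : ∀ s ≤ T, |z s| ≤ W) (hT1 : t₁ ≤ T) (hT : A t₁ + 2 * τ + 1 ≤ A T) :
    z T ≤ max (Real.exp (-1)) (contractionFactor β τ) * W := by
  have hW0 : 0 ≤ W := (abs_nonneg _).trans (hW T le_rfl)
  set κ := max (Real.exp (-1)) (contractionFactor β τ) with hκ
  have hκ1 : Real.exp (-1) ≤ κ := le_max_left _ _
  have hκ2 : contractionFactor β τ ≤ κ := le_max_right _ _
  have hκ0 : 0 < κ := (Real.exp_pos _).trans_le hκ1
  have hτ0 : 0 ≤ τ := (Real.log_nonneg (by simp [hβ.le])).trans hτ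
  rcases le_or_gt (z T) 0 with hzT | hzT
  · exact hzT.trans (by positivity)
  obtain ⟨ρ, hρ, hAρ⟩ := R.exists_eq hT1 (v := A T - τ - 1) (by linarith) (by linarith)
  by_cases hex : ∃ s ∈ Icc ρ T, z s ≤ 0
  · have hcont : ContinuousOn z (Icc ρ T) := by
      have := ((hz.absCont T hT1).mono_Icc hρ.1 hρ.2 le_rfl).continuousOn
      rwa [uIcc_of_le hρ.2] at this
    -- the last zero before `T`
    have hcomp : IsCompact (Icc ρ T ∩ z ⁻¹' Iic 0) :=
      isCompact_Icc.of_isClosed_subset (hcont.preimage_isClosed_of_isClosed isClosed_Icc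
        isClosed_Iic) inter_subset_left
    obtain ⟨s, hs, hs0⟩ := hex
    obtain ⟨σ, ⟨hσmem, hσ0⟩, hσmax⟩ := hcomp.exists_isGreatest ⟨s, hs, hs0⟩
    have hpos' : ∀ s ∈ Ioc σ T, 0 < z s := by
      intro s hs
      by_contra! hcon
      exact absurd (hσmax ⟨⟨hσmem.1.trans hs.1.le, hs.2⟩, hcon⟩) (not_le.2 hs.1)
    have hσT : σ < T := lt_of_le_of_ne hσmem.2 (by rintro rfl; exact absurd hσ0 (not_le.2 hzT))
    have hzσ : z σ = 0 := by
      refine le_antisymm hσ0 ?_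
      by_contra! hneg
      obtain ⟨s, hs, hs0⟩ := intermediate_value_Icc hσT.le
        (hcont.mono (Icc_subset_Icc hσmem.1 le_rfl)) ⟨hneg.le, hzT.le⟩
      rcases hs.1.eq_or_lt with rfl | hlt
      · linarith
      · exact absurd (hpos' s ⟨hlt, hs.2⟩) (by rw [hs0]; exact lt_irrefl _)
    have hpos : ∀ s ∈ Icc σ T, 0 ≤ z s := by
      intro s hs
      rcases hs.1.eq_or_lt with rfl | hlt
      · exact hzσ.ge
      · exact (hpos' s ⟨hlt, hs.2⟩).le
    have hσ1 : t₁ ≤ σ := hρ.1.trans hσmem.1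
    have hAσ : A t₁ + τ ≤ A σ := by linarith [R.mono hρ.1 hσmem.1]
    rcases le_total (A T) (A σ + τ) with hcase | hcase
    · exact (R.le_after_zero hz hβ hτ hW hσ1 hAσ hσT.le hzσ hpos hcase).trans (by gcongr)
    · -- beyond intrinsic time `A σ + τ` the delayed values are nonnegative, so `z` decreases
      obtain ⟨q, hq, hAq⟩ := R.exists_eq hT1 (v := A σ + τ) (by linarith) hcase
      have hσq : σ ≤ q := R.le_of_le hσ1 hq.1 (by linarith)
      have hzq := R.le_after_zero hz hβ hτ (fun s hs => hW s (hs.trans hq.2)) hσ1 hAσ hσq hzσ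
        (fun s hs => hpos s ⟨hs.1, hs.2.trans hq.2⟩) hAq.le
      have h1 := R.comparison hz hq.1 hq.2 0 0 (fun t ht => by
        have ht1 := hq.1.trans ht.1
        have hAt := R.mono hq.1 ht.1
        obtain ⟨h1, h2⟩ := R.delay t ht1 (by linarith)
        have h3 := hpos (h t) ⟨R.le_of_le hσ1 h1 (by linarith),
          (R.delay_le t ht1).trans ht.2⟩
        have h4 := mul_nonneg (mul_nonneg (R.nonneg t ht1) h3) (Real.exp_pos (A t)).le
        linarith)
      have h2 : Real.exp (A q) ≤ Real.exp (A T) := by gcongr; linarith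
      refine le_of_mul_le_mul_left ?_ (Real.exp_pos (A T))
      calc Real.exp (A T) * z T ≤ Real.exp (A q) * z q := by linarith
        _ ≤ Real.exp (A q) * (κ * W) := by gcongr; exact hzq.trans (by gcongr)
        _ ≤ Real.exp (A T) * (κ * W) := by gcongr
  · push Not at hex
    -- without zeros, `z' ≤ -a z` during the last unit of intrinsic time
    obtain ⟨q, hq, hAq⟩ := R.exists_eq hT1 (v := A T - 1) (by linarith) (by linarith)
    have h1 := R.comparison hz hq.1 hq.2 0 0 (fun t ht => by
      have ht1 := hq.1.trans ht.1
      have hAt := R.mono hq.1 ht.1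
      obtain ⟨h1, h2⟩ := R.delay t ht1 (by linarith)
      have h3 := hex (h t) ⟨R.le_of_le hρ.1 h1 (by linarith), (R.delay_le t ht1).trans ht.2⟩
      have h4 := mul_nonneg (mul_nonneg (R.nonneg t ht1) h3.le) (Real.exp_pos (A t)).le
      linarith)
    have h2 : Real.exp (A q) = Real.exp (A T) * Real.exp (-1) := by
      rw [hAq, ← Real.exp_add]; ring_nf
    refine le_of_mul_le_mul_left ?_ (Real.exp_pos (A T))
    calc Real.exp (A T) * z T ≤ Real.exp (A q) * z q := by linarith
      _ ≤ Real.exp (A q) * W := by gcongr; exact (le_abs_self _).trans (hW q hq.2)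
      _ = Real.exp (A T) * (Real.exp (-1) * W) := by rw [h2]; ring
      _ ≤ Real.exp (A T) * (κ * W) := by gcongr

/-- Boundedness: under the contraction condition, a bound for `|z|` up to a time `t₂`
sufficiently far beyond `t₁` persists forever. -/
theorem IsDelayRegime.abs_le (R : IsDelayRegime A a b h β τ t₁)
    (hz : SolvesFrom a b h t₁ z) (hβ : 0 < β) (hτ : Real.log (1 + 1 / β) ≤ τ)
    (hκ : contractionFactor β τ < 1) {K t₂ : ℝ} (ht₂ : t₁ ≤ t₂)
    (hA : A t₁ + 2 * τ + 1 ≤ A t₂) (hK : ∀ s ≤ t₂, |z s| ≤ K) (t : ℝ) : |z t| ≤ K := by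
  by_contra! hcon
  have ht : t₂ < t := by
    by_contra! hle
    exact absurd (hK t hle) (not_le.2 hcon)
  have hcont : ContinuousOn (fun s => |z s|) (Icc t₂ t) := by
    have := ((hz.absCont t (ht₂.trans ht.le)).mono_Icc ht₂ ht.le le_rfl).continuousOn
    rw [uIcc_of_le ht.le] at this
    exact this.abs
  obtain ⟨T, hT, hmax⟩ := isCompact_Icc.exists_isMaxOn ⟨t, ht.le, le_rfl⟩ hcont
  have hKT : K < |z T| := hcon.trans_le (hmax ⟨ht.le, le_rfl⟩)
  have hW : ∀ s ≤ T, |z s| ≤ |z T| := by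
    intro s hs
    rcases le_total s t₂ with h1 | h1
    · exact (hK s h1).trans hKT.le
    · exact hmax ⟨h1, hs.trans hT.2⟩
  have hT1 := ht₂.trans hT.1
  have hAT := hA.trans (R.mono ht₂ hT.1)
  have hpos : 0 < |z T| := ((abs_nonneg _).trans (hK t₂ le_rfl)).trans_lt hKT
  have h1 := R.le_contraction hz hβ hτ hW hT1 hAT
  have h2 := R.le_contraction hz.neg hβ hτ (by simpa using hW) hT1 hAT
  have h3 : max (Real.exp (-1)) (contractionFactor β τ) < 1 :=
    max_lt (by rw [Real.exp_lt_one_iff]; norm_num) hκ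
  have h4 : |z T| ≤ max (Real.exp (-1)) (contractionFactor β τ) * |z T| := abs_le'.2 ⟨h1, h2⟩
  nlinarith

/-! ### Room in the parameters -/

theorem contractionFactor_lt_one (hβ : 0 < β)
    (hlog : Real.log ((β ^ 2 + β) / (β ^ 2 + 1)) < Real.exp (-τ) / β) :
    contractionFactor β τ < 1 := by
  have h1 : Real.exp (-(Real.exp (-τ) / β)) < (β ^ 2 + 1) / (β ^ 2 + β) := by
    have h2 := Real.log_inv ((β ^ 2 + β) / (β ^ 2 + 1))
    rw [inv_div] at h2
    rw [← Real.lt_log_iff_exp_lt (by positivity), h2]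
    linarith
  rw [lt_div_iff₀ (by positivity)] at h1
  rw [contractionFactor]
  linarith

/-- The hypotheses leave room: `β` and `h₀` may be increased to `B > 1` and `τ ≥ log (1 + 1 / B)`
with a contraction factor still below `1`. For `β ≤ 1` this is possible because the logarithm
vanishes at `1`. -/
theorem exists_contractionFactor_lt_one {β h₀ : ℝ}
    (hineq : β ≠ 0 → 1 / β * Real.exp (-h₀) > Real.log ((β ^ 2 + β) / (β ^ 2 + 1))) :
    ∃ B τ : ℝ, max β 1 < B ∧ h₀ < τ ∧ Real.log (1 + 1 / B) ≤ τ ∧ contractionFactor B τ < 1 := by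
  set m := max β 1 with hm
  have hm1 : 1 ≤ m := le_max_right _ _
  have hpos : Real.log ((m ^ 2 + m) / (m ^ 2 + 1)) < Real.exp (-h₀) / m := by
    rcases le_total β 1 with h1 | h1
    · rw [hm, max_eq_right h1]
      norm_num
      positivity
    · rw [hm, max_eq_left h1]
      have := hineq (by linarith)
      rwa [one_div_mul_eq_div] at this
  have hlim : ∀ᶠ ε in 𝓝[>] (0 : ℝ), Real.log (((m + ε) ^ 2 + (m + ε)) / ((m + ε) ^ 2 + 1))
      < Real.exp (-(h₀ + ε)) / (m + ε) := by
    refine Filter.Eventually.filter_mono nhdsWithin_le_nhds ?_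
    refine ContinuousAt.eventually_lt ?_ ?_ (by simpa using hpos)
    · refine ContinuousAt.log (ContinuousAt.div (by fun_prop) (by fun_prop) ?_) ?_ <;> positivity
    · refine ContinuousAt.div (by fun_prop) (by fun_prop) ?_
      positivity
  obtain ⟨ε, hε, hε0⟩ := (hlim.and self_mem_nhdsWithin).exists
  have hε0 : 0 < ε := hε0
  set B := m + ε with hB
  have hB1 : 1 < B := by linarith
  refine ⟨B, max (h₀ + ε) (Real.log (1 + 1 / B)), by linarith,
    (by linarith : h₀ < h₀ + ε).trans_le (le_max_left _ _), le_max_right _ _,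
    contractionFactor_lt_one (by linarith) ?_⟩
  rcases max_choice (h₀ + ε) (Real.log (1 + 1 / B)) with h1 | h1
  · rwa [h1]
  · -- at `τ = log (1 + 1 / B)` the condition holds for every `B`, since `log u ≤ u - 1`
    have hB0 : 0 < B := by linarith
    have h2 : Real.exp (-Real.log (1 + 1 / B)) / B = 1 / (B + 1) := by
      rw [Real.exp_neg, Real.exp_log (by positivity)]
      field_simp
    rw [h1, h2]
    refine (Real.log_le_sub_one_of_pos (by positivity)).trans_lt ?_
    rw [div_sub_one (by positivity), div_lt_div_iff₀ (by positivity) (by positivity)]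
    nlinarith

/-! ### Growth and rescaling of solutions -/

theorem SolvesFrom.mono {t₂ : ℝ} (hz : SolvesFrom a b h t₁ z) (ht : t₁ ≤ t₂) :
    SolvesFrom a b h t₂ z where
  absCont T hT := (hz.absCont T (ht.trans hT)).mono_Icc ht hT le_rfl
  equation := by
    filter_upwards [hz.equation] with t h1 h2
    exact h1 (ht.trans h2)

/-- Multiplication by `exp (α (t - t₀))` turns a solution into a solution of an equation of the
same form, so that exponential decay follows from boundedness for slightly perturbed
coefficients. -/
theorem SolvesFrom.exp_mul (hz : SolvesFrom a b h t₁ z) (α t₀ : ℝ) :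
    SolvesFrom (fun t => a t - α) (fun t => b t * Real.exp (α * (t - h t))) h t₁
      (fun t => Real.exp (α * (t - t₀)) * z t) where
  absCont T hT := by
    have h1 : ContDiff ℝ 1 (fun t : ℝ => Real.exp (α * (t - t₀))) := by fun_prop
    exact h1.contDiffOn.absolutelyContinuousOnInterval.mul (hz.absCont T hT)
  equation := by
    filter_upwards [hz.equation] with t ht h1
    have h2 : HasDerivAt (fun t : ℝ => Real.exp (α * (t - t₀)))
        (Real.exp (α * (t - t₀)) * (α * 1)) t :=
      (((hasDerivAt_id t).sub_const t₀).const_mul α).exp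
    refine (h2.mul (ht h1)).congr_deriv ?_
    have h3 : Real.exp (α * (t - t₀))
        = Real.exp (α * (t - h t)) * Real.exp (α * (h t - t₀)) := by
      rw [← Real.exp_add]; ring_nf
    rw [h3]
    ring

/-- Solutions of the equation with coefficients bounded by `C` grow at most like `exp (2 C t)`. -/
theorem SolvesFrom.abs_le_exp (hz : SolvesFrom a b h t₁ z) {C K : ℝ} (hC : 0 < C)
    (ha : ∀ᵐ t, t₁ ≤ t → |a t| ≤ C) (hb : ∀ᵐ t, t₁ ≤ t → |b t| ≤ C)
    (hh : ∀ t ≥ t₁, h t ≤ t) (hK : ∀ s ≤ t₁, |z s| ≤ K) {t : ℝ} (ht : t₁ ≤ t) :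
    |z t| ≤ K * Real.exp (2 * C * (t - t₁)) := by
  have hK0 : 0 ≤ K := (abs_nonneg _).trans (hK t₁ le_rfl)
  have hcont : ContinuousOn (fun s => |z s| * Real.exp (-(2 * C * (s - t₁)))) (Icc t₁ t) := by
    have := (hz.absCont t ht).continuousOn
    rw [uIcc_of_le ht] at this
    exact this.abs.mul (by fun_prop)
  obtain ⟨T, hT, hmax⟩ := isCompact_Icc.exists_isMaxOn ⟨t₁, le_rfl, ht⟩ hcont
  set W := |z T| * Real.exp (-(2 * C * (T - t₁))) with hW
  have hexp : ∀ s u : ℝ, u * Real.exp (-(2 * C * (s - t₁))) * Real.exp (2 * C * (s - t₁)) = u := by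
    intro s u
    rw [mul_assoc, ← Real.exp_add]; simp
  have hle : ∀ s ∈ Icc t₁ t, |z s| ≤ W * Real.exp (2 * C * (s - t₁)) := by
    intro s hs
    have h1 : |z s| * Real.exp (-(2 * C * (s - t₁))) ≤ W := hmax hs
    have h2 := mul_le_mul_of_nonneg_right h1 (Real.exp_pos (2 * C * (s - t₁))).le
    rwa [hexp] at h2
  suffices hWK : W ≤ K from (hle t ⟨ht, le_rfl⟩).trans (by gcongr)
  by_contra! hKW
  have hW0 : 0 < W := hK0.trans_lt hKW
  have hdelayed : ∀ s ∈ Icc t₁ T, |z (h s)| ≤ W * Real.exp (2 * C * (s - t₁)) := by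
    intro s hs
    rcases le_total (h s) t₁ with h1 | h1
    · have h2 : 1 ≤ Real.exp (2 * C * (s - t₁)) :=
        Real.one_le_exp (mul_nonneg (by positivity) (by linarith [hs.1]))
      nlinarith [hK (h s) h1]
    · have h2 := hh s hs.1
      refine (hle (h s) ⟨h1, h2.trans (hs.2.trans hT.2)⟩).trans ?_
      gcongr
  -- neither `z` nor `-z` can reach the barrier `W exp (2 C (t - t₁))`
  have key : ∀ y : ℝ → ℝ, SolvesFrom a b h t₁ y → (∀ s, |y s| = |z s|) →
      y T - W * Real.exp (2 * C * (T - t₁)) ≤ y t₁ - W := by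
    intro y hy hyz
    have hE : ContDiff ℝ 1 (fun s : ℝ => W * Real.exp (2 * C * (s - t₁))) := by fun_prop
    have hF := (hy.absCont T hT.1).sub
      (hE.contDiffOn (s := uIcc t₁ T)).absolutelyContinuousOnInterval
    have h1 := hF.le_of_ae_hasDerivAt_nonpos hT.1 (by
      filter_upwards [hy.equation, ha, hb] with s hys has hbs hs
      have hys := hys hs.1
      have h2 : HasDerivAt (fun s : ℝ => W * Real.exp (2 * C * (s - t₁)))
          (W * (Real.exp (2 * C * (s - t₁)) * (2 * C * 1))) s :=
        ((((hasDerivAt_id s).sub_const t₁).const_mul (2 * C)).exp).const_mul W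
      refine ⟨_, ?_, hys.sub h2⟩
      have h3 : |a s * y s| ≤ C * (W * Real.exp (2 * C * (s - t₁))) := by
        rw [abs_mul, hyz]
        exact mul_le_mul (has hs.1) (hle s ⟨hs.1, hs.2.trans hT.2⟩) (abs_nonneg _) hC.le
      have h4 : |b s * y (h s)| ≤ C * (W * Real.exp (2 * C * (s - t₁))) := by
        rw [abs_mul, hyz]
        exact mul_le_mul (hbs hs.1) (hdelayed s hs) (abs_nonneg _) hC.le
      have h5 := (abs_le.1 h3).1
      have h6 := (abs_le.1 h4).1
      linarith)
    simpa using h1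
  have h1 := key z hz fun _ => rfl
  have h2 := key _ hz.neg fun _ => abs_neg _
  have h3 : W * Real.exp (2 * C * (T - t₁)) = |z T| := hexp T _
  have h4 := abs_le.1 (hK t₁ le_rfl)
  rw [h3] at h1 h2
  rcases abs_choice (z T) with h5 | h5 <;> rw [h5] at h1 h2 <;> linarith

/-! ### Coefficients in intrinsic time -/

theorem MeasureTheory.MemLp.exists_ae_abs_le {f : ℝ → ℝ}
    (hf : MemLp f ⊤ (volume.restrict (Ici (0 : ℝ)))) :
    ∃ C > 0, ∀ᵐ t, 0 ≤ t → |f t| ≤ C := by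
  have h1 : eLpNormEssSup f (volume.restrict (Ici (0 : ℝ))) < ⊤ := by
    simpa using hf.eLpNorm_lt_top
  refine ⟨(eLpNormEssSup f (volume.restrict (Ici (0 : ℝ)))).toReal + 1, by positivity, ?_⟩
  have h2 := ae_le_eLpNormEssSup (f := f) (μ := volume.restrict (Ici (0 : ℝ)))
  rw [ae_restrict_iff' measurableSet_Ici] at h2
  filter_upwards [h2] with t ht h0
  have h3 := ENNReal.toReal_mono h1.ne (ht h0)
  simp only [toReal_enorm, Real.norm_eq_abs] at h3
  linarith

theorem MeasureTheory.MemLp.intervalIntegrable_of_nonneg {f : ℝ → ℝ}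
    (hf : MemLp f ⊤ (volume.restrict (Ici (0 : ℝ)))) {s t : ℝ} (hs : 0 ≤ s) (ht : 0 ≤ t) :
    IntervalIntegrable f volume s t := by
  rw [intervalIntegrable_iff]
  have hsub : uIoc s t ⊆ Ici 0 := fun u hu => (le_min hs ht).trans hu.1.le
  have h1 : MemLp f ⊤ (volume.restrict (uIoc s t)) :=
    hf.mono_measure (Measure.restrict_mono hsub le_rfl)
  have : IsFiniteMeasure (volume.restrict (uIoc s t)) := ⟨by simp [uIoc]⟩
  exact h1.integrable le_top

theorem ae_hasDerivAt_primitive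
    (hint : ∀ s t : ℝ, 0 ≤ s → 0 ≤ t → IntervalIntegrable a volume s t) :
    ∀ᵐ t, 0 ≤ t → HasDerivAt (fun u => ∫ s in (0 : ℝ)..u, a s) (a t) t := by
  have h1 : ∀ n : ℕ, ∀ᵐ t, t ∈ uIcc (0 : ℝ) n →
      ∀ c ∈ uIcc (0 : ℝ) n, HasDerivAt (fun u => ∫ s in c..u, a s) (a t) t :=
    fun n => (hint 0 n le_rfl n.cast_nonneg).ae_hasDerivAt_integral
  filter_upwards [ae_all_iff.2 h1] with t ht h0
  obtain ⟨n, hn⟩ := exists_nat_ge t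
  refine ht n ?_ 0 left_mem_uIcc
  rw [uIcc_of_le (h0.trans hn)]
  exact ⟨h0, hn⟩

/-- Increments of the primitive of a function bounded below. -/
theorem mul_le_primitive_sub {c : ℝ}
    (hint : ∀ s t : ℝ, 0 ≤ s → 0 ≤ t → IntervalIntegrable a volume s t)
    (hc : ∀ t ≥ 0, c ≤ a t) {s t : ℝ} (hs : 0 ≤ s) (hst : s ≤ t) :
    c * (t - s) ≤ (∫ u in (0 : ℝ)..t, a u) - ∫ u in (0 : ℝ)..s, a u := by
  rw [intervalIntegral.integral_interval_sub_left (hint _ _ le_rfl (hs.trans hst))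
    (hint _ _ le_rfl hs)]
  have h1 := intervalIntegral.integral_mono_on hst intervalIntegrable_const
    (hint _ _ hs (hs.trans hst)) (f := fun _ => c) fun u hu => hc u (hs.trans hu.1)
  simpa [mul_comm] using h1

/-- The exponentially weighted coefficients `a - α` and `b exp (α (t - h))` form a delay regime
in the intrinsic time `∫ (a - α)`. -/
theorem isDelayRegime_exp_mul {a₀ α B b₁ D : ℝ}
    (hint : ∀ s t : ℝ, 0 ≤ s → 0 ≤ t → IntervalIntegrable a volume s t)
    (hα : 0 ≤ α) (hαa : α < a₀) (ha_ge : ∀ t ≥ 0, a₀ ≤ a t) (hB : 0 ≤ B) (ht₁ : 0 ≤ t₁)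
    (hb : ∀ t ≥ t₁, 0 ≤ b t) (hba : ∀ t ≥ t₁, b t ≤ b₁ * a t)
    (hh_le : ∀ t ≥ t₁, h t ≤ t) (hh0 : ∀ t ≥ t₁, 0 ≤ h t)
    (hτ : ∀ t ≥ t₁, ∫ s in (h t)..t, a s ≤ τ) (hD : τ ≤ a₀ * D)
    (hroom : b₁ * Real.exp (α * D) * a₀ ≤ B * (a₀ - α)) :
    IsDelayRegime (fun t => ∫ s in (0 : ℝ)..t, (a s - α)) (fun t => a t - α)
      (fun t => b t * Real.exp (α * (t - h t))) h B τ t₁ := by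
  have ha₀ : 0 < a₀ := hα.trans_lt hαa
  have hint' : ∀ s t : ℝ, 0 ≤ s → 0 ≤ t → IntervalIntegrable (fun u => a u - α) volume s t :=
    fun s t hs ht => (hint s t hs ht).sub intervalIntegrable_const
  have hmono : StrictMonoOn (fun t => ∫ s in (0 : ℝ)..t, (a s - α)) (Ici 0) := by
    intro s hs t ht hst
    have h1 := mul_le_primitive_sub hint' (c := a₀ - α)
      (fun t ht => by linarith [ha_ge t ht]) hs hst.le
    have h2 : 0 < (a₀ - α) * (t - s) := mul_pos (by linarith) (by linarith)
    dsimp only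
    linarith
  have hdelay : ∀ t ≥ t₁, t - h t ≤ D := by
    intro t ht
    have h1 := mul_le_primitive_sub hint ha_ge (hh0 t ht) (hh_le t ht)
    rw [intervalIntegral.integral_interval_sub_left (hint _ _ le_rfl (ht₁.trans ht))
      (hint _ _ le_rfl (hh0 t ht))] at h1
    have h2 := h1.trans ((hτ t ht).trans hD)
    exact le_of_mul_le_mul_left h2 ha₀
  refine ⟨fun T hT => ?_, ?_, hmono.mono (Ici_subset_Ici.2 ht₁), fun t ht => ?_, fun t ht => ?_,
    hh_le, fun t ht hA => ?_⟩
  · exact ((hint' 0 T le_rfl (ht₁.trans hT)).absolutelyContinuousOnInterval_intervalIntegral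
      left_mem_uIcc).mono_Icc ht₁ hT le_rfl
  · filter_upwards [ae_hasDerivAt_primitive hint'] with t h1 h2
    exact h1 (ht₁.trans h2)
  · exact mul_nonneg (hb t ht) (Real.exp_pos _).le
  · have h1 := ha_ge t (ht₁.trans ht)
    have h2 : b t * Real.exp (α * (t - h t)) ≤ b₁ * a t * Real.exp (α * D) := by
      have h3 := hba t ht
      have h4 := hdelay t ht
      have h5 := (hb t ht).trans h3
      gcongr
    have h3 : a t * (b₁ * Real.exp (α * D) * a₀) ≤ a t * (B * (a₀ - α)) := by
      have : 0 ≤ a t := ha₀.le.trans h1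
      gcongr
    -- `a (1 - α / a₀) ≤ a - α` because `a ≥ a₀`
    have h4 : B * α * a₀ ≤ B * α * a t := by gcongr
    refine le_of_mul_le_mul_right ?_ ha₀
    nlinarith
  · have ht0 : 0 ≤ t := ht₁.trans ht
    have h1 : (∫ s in (0 : ℝ)..t, (a s - α)) - ∫ s in (0 : ℝ)..(h t), (a s - α) ≤ τ := by
      rw [intervalIntegral.integral_interval_sub_left (hint' _ _ le_rfl ht0)
        (hint' _ _ le_rfl (hh0 t ht))]
      refine le_trans ?_ (hτ t ht)
      exact intervalIntegral.integral_mono_on (hh_le t ht) (hint' _ _ (hh0 t ht) ht0)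
        (hint _ _ (hh0 t ht) ht0) fun u _ => by linarith
    refine ⟨(hmono.le_iff_le ht₁ (hh0 t ht)).1 ?_, ?_⟩ <;> linarith

/-! ### Exponential stability -/

theorem IsDelaySolution.solvesFrom {t₀ : ℝ} {φ x : ℝ → ℝ} (hx : IsDelaySolution a b h t₀ φ x) :
    SolvesFrom a b h t₀ x where
  absCont := hx.absCont
  equation := (ae_restrict_iff' measurableSet_Ici).1 hx.equation

theorem theorem2 (a b h : ℝ → ℝ)
    -- `a`, `b` are Lebesgue measurable and essentially bounded on `[0, ∞)`
    (ha : MemLp a ⊤ (volume.restrict (Ici (0 : ℝ))))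
    (hb : MemLp b ⊤ (volume.restrict (Ici (0 : ℝ))))
    -- `h` is Lebesgue measurable on `[0, ∞)`, `h(t) ≤ t`, and `h(t) → ∞`
    (hh : AEMeasurable h (volume.restrict (Ici (0 : ℝ))))
    (hh_le : ∀ t ≥ 0, h t ≤ t)
    (hh_lim : Tendsto h atTop atTop)
    (a₀ : ℝ) (ha₀ : 0 < a₀) (ha_ge : ∀ t ≥ 0, a₀ ≤ a t)
    (hb_nonneg : ∀ t ≥ 0, 0 ≤ b t)
    -- the upper limits, taken in `[-∞, ∞]`, are the finite numbers `h₀` and `β`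
    (h₀ β : ℝ)
    (hh₀ : limsup (fun t : ℝ => ((∫ s in (h t)..t, a s : ℝ) : EReal)) atTop = (h₀ : EReal))
    (hβ : limsup (fun t : ℝ => ((b t / a t : ℝ) : EReal)) atTop = (β : EReal))
    -- for `β = 0` the inequality is read as `+∞ > -∞`, so it imposes nothing
    (hineq : β ≠ 0 →
      1 / β * Real.exp (-h₀) > Real.log ((β ^ 2 + β) / (β ^ 2 + 1))) :
    IsExponentiallyStable a b h := by
  obtain ⟨B, τ, hB, hτ₀, hτ, hκ⟩ := exists_contractionFactor_lt_one hineq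
  obtain ⟨b₁, hb₁, hb₁B⟩ := exists_between hB
  have hb₁1 : 1 < b₁ := (le_max_right β 1).trans_lt hb₁
  have hB1 : 1 < B := hb₁1.trans hb₁B
  have hτ0 : 0 ≤ τ := by
    refine (Real.log_nonneg ?_).trans hτ
    have : 0 < 1 / B := by positivity
    linarith
  have hev1 : ∀ᶠ t in atTop, ∫ s in (h t)..t, a s ≤ τ := by
    have h1 : limsup (fun t : ℝ => ((∫ s in (h t)..t, a s : ℝ) : EReal)) atTop < (τ : EReal) := by
      rw [hh₀]; exact_mod_cast hτ₀
    filter_upwards [eventually_lt_of_limsup_lt h1] with t ht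
    exact (EReal.coe_lt_coe_iff.1 ht).le
  have hev2 : ∀ᶠ t in atTop, b t / a t ≤ b₁ := by
    have h1 : limsup (fun t : ℝ => ((b t / a t : ℝ) : EReal)) atTop < (b₁ : EReal) := by
      rw [hβ]; exact_mod_cast (le_max_left β 1).trans_lt hb₁
    filter_upwards [eventually_lt_of_limsup_lt h1] with t ht
    exact (EReal.coe_lt_coe_iff.1 ht).le
  obtain ⟨T₁, hT₁⟩ := eventually_atTop.1
    (((hev1.and hev2).and (hh_lim.eventually_ge_atTop 0)).and (eventually_ge_atTop 0))
  have hT₁0 : 0 ≤ T₁ := (hT₁ T₁ le_rfl).2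
  -- the decay rate: small enough for the weighted coefficients to keep the ratio below `B`
  obtain ⟨α, hα0, hαa, hroom⟩ : ∃ α > 0, α < a₀ ∧
      b₁ * Real.exp (α * (τ / a₀)) * a₀ ≤ B * (a₀ - α) := by
    have h1 : ∀ᶠ α in 𝓝 (0 : ℝ), b₁ * Real.exp (α * (τ / a₀)) * a₀ < B * (a₀ - α) := by
      refine ContinuousAt.eventually_lt (by fun_prop) (by fun_prop) ?_
      simpa using mul_lt_mul_of_pos_right hb₁B ha₀
    have h2 : ∀ᶠ α in 𝓝 (0 : ℝ), α < a₀ := eventually_lt_nhds ha₀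
    obtain ⟨α, ⟨h3, h4⟩, h5⟩ :=
      (((h1.and h2).filter_mono nhdsWithin_le_nhds).and
        (self_mem_nhdsWithin : Ioi (0 : ℝ) ∈ 𝓝[>] 0)).exists
    exact ⟨α, h5, h4, h3.le⟩
  obtain ⟨C₁, hC₁, haC⟩ := ha.exists_ae_abs_le
  obtain ⟨C₂, hC₂, hbC⟩ := hb.exists_ae_abs_le
  set C := max C₁ C₂ with hC
  have hC0 : 0 < C := hC₁.trans_le (le_max_left _ _)
  have hgap : 0 < a₀ - α := by linarith
  set L := T₁ + (2 * τ + 1) / (a₀ - α) with hL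
  refine ⟨Real.exp ((2 * C + α) * L), Real.exp_pos _, α, hα0, ?_⟩
  intro t₀ ht₀ φ x hφ hx t ht
  set K := ⨆ s : Iic t₀, |φ s| with hKdef
  have hK : ∀ s ≤ t₀, |x s| ≤ K := by
    intro s hs
    rw [hx.initial s hs]
    obtain ⟨c, hc⟩ := hφ.bounded
    refine le_ciSup (f := fun s : Iic t₀ => |φ s|) ⟨c, ?_⟩ ⟨s, hs⟩
    rintro _ ⟨u, rfl⟩
    exact hc u u.2
  have hK0 : 0 ≤ K := (abs_nonneg _).trans (hK t₀ le_rfl)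
  have hsol := hx.solvesFrom
  have hgrow : ∀ s ≥ t₀, |x s| ≤ K * Real.exp (2 * C * (s - t₀)) := by
    intro s hs
    refine hsol.abs_le_exp hC0 ?_ ?_ (fun t ht => hh_le t (ht₀.trans ht)) hK hs
    · filter_upwards [haC] with t h1 h2
      exact (h1 (ht₀.trans h2)).trans (le_max_left _ _)
    · filter_upwards [hbC] with t h1 h2
      exact (h1 (ht₀.trans h2)).trans (le_max_right _ _)
  set t₁ := max t₀ T₁ with ht₁
  have ht₁T : T₁ ≤ t₁ := le_max_right _ _
  have ht₁0 : 0 ≤ t₁ := hT₁0.trans ht₁T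
  have hint : ∀ s t : ℝ, 0 ≤ s → 0 ≤ t → IntervalIntegrable a volume s t :=
    fun s t hs ht => ha.intervalIntegrable_of_nonneg hs ht
  have R := isDelayRegime_exp_mul (h := h) (b := b) hint hα0.le hαa ha_ge (by linarith : 0 ≤ B)
    ht₁0 (fun t ht => hb_nonneg t (ht₁0.trans ht))
    (fun t ht => (div_le_iff₀ (ha₀.trans_le (ha_ge t (ht₁0.trans ht)))).1
      (hT₁ t (ht₁T.trans ht)).1.1.2)
    (fun t ht => hh_le t (ht₁0.trans ht)) (fun t ht => (hT₁ t (ht₁T.trans ht)).1.2)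
    (fun t ht => (hT₁ t (ht₁T.trans ht)).1.1.1) (mul_div_cancel₀ τ ha₀.ne').ge hroom
  have hz := (hsol.mono (le_max_left t₀ T₁)).exp_mul α t₀
  set t₂ := t₁ + (2 * τ + 1) / (a₀ - α) with ht₂
  have hstep : 0 ≤ (2 * τ + 1) / (a₀ - α) := by positivity
  have hA : (∫ s in (0 : ℝ)..t₁, (a s - α)) + 2 * τ + 1 ≤ ∫ s in (0 : ℝ)..t₂, (a s - α) := by
    have h1 := mul_le_primitive_sub (a := fun u => a u - α) (c := a₀ - α)
      (fun s t hs ht => (hint s t hs ht).sub intervalIntegrable_const)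
      (fun t ht => by linarith [ha_ge t ht]) ht₁0 (by linarith : t₁ ≤ t₂)
    have h2 : (a₀ - α) * (t₂ - t₁) = 2 * τ + 1 := by
      rw [ht₂]; field_simp; ring
    linarith
  have hL0 : 0 ≤ L := by positivity
  have ht₂L : t₂ ≤ t₀ + L := by
    have : t₁ ≤ t₀ + T₁ := max_le (by linarith) (by linarith)
    linarith
  have hinit : ∀ s ≤ t₂, |Real.exp (α * (s - t₀)) * x s| ≤ K * Real.exp ((2 * C + α) * L) := by
    intro s hs
    rw [abs_mul, abs_of_pos (Real.exp_pos _)]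
    rcases le_total s t₀ with h1 | h1
    · have h2 : Real.exp (α * (s - t₀)) ≤ 1 :=
        Real.exp_le_one_iff.2 (mul_nonpos_of_nonneg_of_nonpos hα0.le (by linarith))
      have h3 : 1 ≤ Real.exp ((2 * C + α) * L) := Real.one_le_exp (by positivity)
      have h4 := hK s h1
      have h5 := abs_nonneg (x s)
      have h6 := Real.exp_pos (α * (s - t₀))
      nlinarith
    · calc Real.exp (α * (s - t₀)) * |x s|
          ≤ Real.exp (α * (s - t₀)) * (K * Real.exp (2 * C * (s - t₀))) := by
            gcongr; exact hgrow s h1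
        _ = K * Real.exp ((2 * C + α) * (s - t₀)) := by
            rw [mul_left_comm, ← Real.exp_add]; ring_nf
        _ ≤ K * Real.exp ((2 * C + α) * L) := by
            gcongr; linarith
  have hfin := R.abs_le hz (by linarith) hτ hκ (by linarith) hA hinit t
  rw [abs_mul, abs_of_pos (Real.exp_pos _)] at hfin
  have h1 : Real.exp (-α * (t - t₀)) * Real.exp (α * (t - t₀)) = 1 := by
    rw [← Real.exp_add]; simp
  calc |x t| = Real.exp (-α * (t - t₀)) * (Real.exp (α * (t - t₀)) * |x t|) := by
        rw [← mul_assoc, h1, one_mul]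
    _ ≤ Real.exp (-α * (t - t₀)) * (K * Real.exp ((2 * C + α) * L)) := by gcongr
    _ = _ := by ring
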